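/- Conventions. Let $\mathscr S$ be a bicategory. An equivalence is a 1-cell that has a pseudo-inverse up to invertible 2-cells. A square $a\circ p\cong b\circ q$ with vertex $P$ over a cospan $X\xrightarrow{a}Z\xleftarrow{b}Y$ is a *bipullback* if for every object $K$ the induced functor from $\mathscr S(K,P)$ to the pseudo-pullback (iso-comma category) of $\mathscr S(K,X)\to\mathscr S(K,Z)\leftarrow\mathscr S(K,Y)$ is an equivalence of categories. A *factorization system* $(\mathscr U,\mathscr L)$ on $\mathscr S$ consists of two classes of 1-cells, each containing the equivalences and closed under composition and under invertible 2-cells, such that every 1-cell $f$ is isomorphic to some $m\circ e$ with $e\in\mathscr U$, $m\in\mathscr L$, and such that for all $e:X\to Y$ in $\mathscr U$ and $m:A\to B$ in $\mathscr L$ the canonical functor from $\mathscr S(Y,A)$ to the pseudo-pullback of $\mathscr S(X,A)\xrightarrow{m\circ-}\mathscr S(X,B)\xleftarrow{-\circ e}\mathscr S(Y,B)$ is an equivalence. $\mathscr S$ is *fake pullback ready* if it is locally preordered (there is at most one 2-cell between two parallel 1-cells) and is equipped with a factorization system $(\mathscr U,\mathscr L)$ such that: * **V1.** Every cospan of two members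 of $\mathscr U$ has a bipullback with both projections in $\mathscr U$, and every cospan of two members of $\mathscr L$ has a bipullback with both projections in $\mathscr L$. * **V2.** For $a:X\to Z$ in $\mathscr U$ and $x:Y\to Z$ in $\mathscr L$ there are $T$, $b:T\to Y$ in $\mathscr U$ and $y:T\to X$ in $\mathscr L$ with a 2-cell $x\circ b\Rightarrow a\circ y$; and $(T,b,y)$ is unique up to equivalence, that is, for any other such $(T',b',y')$ there is an equivalence $e:T\to T'$ with $b'\circ e\cong b$ and $y'\circ e\cong y$. * **V3.** Given $x:X\to Y$, $r:X\to A$, $s:Y\to B$, $y:A\to B$, $t:Z\to C$ in $\mathscr L$ and $a:Y\to Z$, $b:B\to C$ in $\mathscr U$ such that $s\circ x\cong y\circ r$ is a bipullback and there is a 2-cell $t\circ a\Rightarrow b\circ s$, and given factorizations $a\circ x\cong v\circ c$ through $I$ and $b\circ y\cong w\circ d$ through $J$ with $v,w\in\mathscr L$ and $c,d\in\mathscr U$, there is $q:I\to J$ in $\mathscr L$ with a 2-cell $q\circ c\Rightarrow d\circ r$ and a bipullback $t\circ v\cong w\circ q$. * **V4.** Given $u:D\to E$, $x:X\to Y$ in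 $\mathscr L$ and $h:E\to F$, $a:Y\to Z$, $e:D\to X$, $f:E\to Y$, $g:F\to Z$ in $\mathscr U$ such that $g\circ h\cong a\circ f$ is a bipullback and there is a 2-cell $x\circ e\Rightarrow f\circ u$, and given factorizations $h\circ u\cong p\circ k$ through $K$ and $a\circ x\cong v\circ c$ through $I$ with $v,p\in\mathscr L$ and $c,k\in\mathscr U$, there is $j:K\to I$ in $\mathscr U$ with a bipullback $j\circ k\cong c\circ e$ and a 2-cell $v\circ j\Rightarrow g\circ p$. Let $\mathscr S$ be fake pullback ready. A *fake pullback* of a cospan $U\xrightarrow{r}W\xleftarrow{s}V$ is any span $U\xleftarrow{\bar y\circ b'}Q\xrightarrow{\bar x\circ a'}V$ obtained as follows: factorize $r\cong x\circ a$ and $s\cong y\circ b$ with $a:U\to R$, $b:V\to S$ in $\mathscr U$ and $x:R\to W$, $y:S\to W$ in $\mathscr L$; take a bipullback $S\xleftarrow{x'}Z\xrightarrow{y'}R$ of $y$ and $x$ with $x',y'\in\mathscr L$; take squares as in V2, $y'\circ\bar a\Rightarrow a\circ\bar y$ with $\bar a:X\to Z$ in $\mathscr U$ and $\bar y:X\to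 U$ in $\mathscr L$, and $x'\circ\bar b\Rightarrow b\circ\bar x$ with $\bar b:Y\to Z$ in $\mathscr U$ and $\bar x:Y\to V$ in $\mathscr L$; and take a bipullback $Y\xleftarrow{a'}Q\xrightarrow{b'}X$ of $\bar b$ and $\bar a$ with $a',b'\in\mathscr U$. A span from $X$ to $Y$ is a diagram $X\leftarrow R\to Y$. Two spans from $X$ to $Y$ are isomorphic if there is an equivalence between their apexes that commutes with both legs up to invertible 2-cells. **Theorem.** Let $\mathscr S$ be a fake pullback ready bicategory. Every cospan in $\mathscr S$ has a fake pullback, and there is a category $\mathrm{Spn}[\mathscr S]$ whose objects are those of $\mathscr S$, whose morphisms $X\to Y$ are the isomorphism classes of spans from $X$ to $Y$, whose identities are the classes of the identity spans $X\xleftarrow{1}X\xrightarrow{1}X$, and whose composition is given by fake pullback: for spans $X\xleftarrow{l}A\xrightarrow{r}Y$ and $Y\xleftarrow{s}B\xrightarrow{t}Z$ and every fake pullback $A\xleftarrow{\bar s}Q\xrightarrow{\bar r}B$ of $A\xrightarrow{r}Y\xleftarrow{s}B$, the composite of their classes is the class of $X\xleftarrow{l\circ\bar s}Q\xrightarrow{t\circ\bar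 r}Z$. -/

import Mathlib

open CategoryTheory Bicategory Limits

universe w v u

namespace FakePullbacks

section Bicategorical

variable {S : Type u} [Bicategory.{w, v} S]

/-- A 1-cell is an equivalence if it has a pseudo-inverse, up to invertible 2-cells. -/
def IsEquivalence {X Y : S} (f : X ⟶ Y) : Prop :=
  ∃ g : Y ⟶ X, Nonempty (f ≫ g ≅ 𝟙 X) ∧ Nonempty (g ≫ f ≅ 𝟙 Y)

/-- For a square `p ≫ a ≅ q ≫ b` with vertex `P`, the canonical functor from `S(K, P)` to the
pseudo-pullback (iso-comma category) of `S(K, X) ⥤ S(K, Z)` and `S(K, Y) ⥤ S(K, Z)`. -/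
def bipullbackComparison {P X Y Z : S} {p : P ⟶ X} {q : P ⟶ Y} {a : X ⟶ Z} {b : Y ⟶ Z}
    (α : p ≫ a ≅ q ≫ b) (K : S) :
    (K ⟶ P) ⥤ CategoricalPullback (postcomp K a) (postcomp K b) where
  obj k := ⟨k ≫ p, k ≫ q, α_ k p a ≪≫ whiskerLeftIso k α ≪≫ (α_ k q b).symm⟩
  map {k l} f := ⟨f ▷ p, f ▷ q, by
    change f ▷ p ▷ a ≫ (α_ l p a).hom ≫ l ◁ α.hom ≫ (α_ l q b).inv =
      ((α_ k p a).hom ≫ k ◁ α.hom ≫ (α_ k q b).inv) ≫ f ▷ q ▷ b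
    rw [Category.assoc, Category.assoc, associator_naturality_left_assoc,
      ← whisker_exchange_assoc, associator_inv_naturality_left]⟩

/-- The square with sides `p, q, a, b` commutes up to an invertible 2-cell that exhibits it as a
bipullback of the cospan `X ⟶ Z ⟵ Y` formed by `a` and `b`. -/
def IsBipullback {P X Y Z : S} (p : P ⟶ X) (q : P ⟶ Y) (a : X ⟶ Z) (b : Y ⟶ Z) : Prop :=
  ∃ α : p ≫ a ≅ q ≫ b, ∀ K : S, (bipullbackComparison α K).IsEquivalence

/-- The canonical functor from `S(Y, A)` to the pseudo-pullback of
`S(X, m) : S(X, A) ⥤ S(X, B)` and `S(e, B) : S(Y, B) ⥤ S(X, B)`. -/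
def orthogonalityComparison {X Y A B : S} (e : X ⟶ Y) (m : A ⟶ B) :
    (Y ⟶ A) ⥤ CategoricalPullback (postcomp X m) (precomp B e) where
  obj k := ⟨e ≫ k, k ≫ m, α_ e k m⟩
  map f := ⟨e ◁ f, f ▷ m, associator_naturality_middle e f m⟩

end Bicategorical

/-- A factorization system `(U, L)` on a bicategory. -/
structure FactorizationSystem (S : Type u) [Bicategory.{w, v} S] where
  /-- The left class. -/
  U : MorphismProperty S
  /-- The right class. -/
  L : MorphismProperty S
  U_of_isEquivalence : ∀ {X Y : S} (f : X ⟶ Y), IsEquivalence f → U f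
  L_of_isEquivalence : ∀ {X Y : S} (f : X ⟶ Y), IsEquivalence f → L f
  U_comp : ∀ {X Y Z : S} (f : X ⟶ Y) (g : Y ⟶ Z), U f → U g → U (f ≫ g)
  L_comp : ∀ {X Y Z : S} (f : X ⟶ Y) (g : Y ⟶ Z), L f → L g → L (f ≫ g)
  U_of_iso : ∀ {X Y : S} {f g : X ⟶ Y}, (f ≅ g) → U f → U g
  L_of_iso : ∀ {X Y : S} {f g : X ⟶ Y}, (f ≅ g) → L f → L g
  /-- The square of hom-categories determined by `e ∈ U` and `m ∈ L` is a bipullback. -/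
  orthogonal : ∀ {X Y A B : S} (e : X ⟶ Y) (m : A ⟶ B), U e → L m →
    (orthogonalityComparison e m).IsEquivalence
  exists_factorization : ∀ {X Y : S} (f : X ⟶ Y),
    ∃ (I : S) (e : X ⟶ I) (m : I ⟶ Y), U e ∧ L m ∧ Nonempty (e ≫ m ≅ f)

variable {S : Type u} [Bicategory.{w, v} S]

/-- A locally preordered bicategory equipped with the factorization system `F = (U, L)` is fake
pullback ready. Composites are written in diagrammatic order: `f ≫ g` is `g ∘ f`. As there is at
most one 2-cell between parallel 1-cells, it suffices to require that the 2-cells exist. -/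
structure FakePullbackReady (F : FactorizationSystem S) : Prop where
  /-- `S` is locally preordered. -/
  locally_preordered : ∀ X Y : S, Quiver.IsThin (X ⟶ Y)
  /-- V1 for `U`. -/
  bipullback_U : ∀ {X Y Z : S} (a : X ⟶ Z) (b : Y ⟶ Z), F.U a → F.U b →
    ∃ (P : S) (p : P ⟶ X) (q : P ⟶ Y), F.U p ∧ F.U q ∧ IsBipullback p q a b
  /-- V1 for `L`. -/
  bipullback_L : ∀ {X Y Z : S} (x : X ⟶ Z) (y : Y ⟶ Z), F.L x → F.L y →
    ∃ (P : S) (p : P ⟶ X) (q : P ⟶ Y), F.L p ∧ F.L q ∧ IsBipullback p q x y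
  /-- V2, existence. -/
  exists_interchange : ∀ {X Y Z : S} (a : X ⟶ Z) (x : Y ⟶ Z), F.U a → F.L x →
    ∃ (T : S) (b : T ⟶ Y) (y : T ⟶ X), F.U b ∧ F.L y ∧ Nonempty (b ≫ x ⟶ y ≫ a)
  /-- V2, uniqueness up to equivalence. -/
  interchange_unique : ∀ {X Y Z : S} (a : X ⟶ Z) (x : Y ⟶ Z), F.U a → F.L x →
    ∀ {T T' : S} (b : T ⟶ Y) (y : T ⟶ X) (b' : T' ⟶ Y) (y' : T' ⟶ X),
      F.U b → F.L y → Nonempty (b ≫ x ⟶ y ≫ a) →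
      F.U b' → F.L y' → Nonempty (b' ≫ x ⟶ y' ≫ a) →
      ∃ e : T ⟶ T', IsEquivalence e ∧ Nonempty (e ≫ b' ≅ b) ∧ Nonempty (e ≫ y' ≅ y)
  /-- V3. -/
  shift_L : ∀ {X Y Z A B C : S} (x : X ⟶ Y) (r : X ⟶ A) (s : Y ⟶ B) (y : A ⟶ B)
    (a : Y ⟶ Z) (t : Z ⟶ C) (b : B ⟶ C),
    F.L r → F.L s → F.L t → F.L x → F.L y → F.U a → F.U b →
    IsBipullback x r s y → Nonempty (a ≫ t ⟶ s ≫ b) →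
    ∀ {I J : S} (c : X ⟶ I) (v : I ⟶ Z) (d : A ⟶ J) (w : J ⟶ C),
      F.L v → F.L w → F.U c → F.U d →
      Nonempty (x ≫ a ≅ c ≫ v) → Nonempty (y ≫ b ≅ d ≫ w) →
      ∃ q : I ⟶ J, F.L q ∧ Nonempty (c ≫ q ⟶ r ≫ d) ∧ IsBipullback v q t w
  /-- V4. -/
  shift_U : ∀ {D E G X Y Z : S} (u : D ⟶ E) (e : D ⟶ X) (f : E ⟶ Y) (x : X ⟶ Y)
    (h : E ⟶ G) (g : G ⟶ Z) (a : Y ⟶ Z),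
    F.L x → F.L u → F.U h → F.U a → F.U e → F.U f → F.U g →
    IsBipullback h f g a → Nonempty (e ≫ x ⟶ u ≫ f) →
    ∀ {K I : S} (k : D ⟶ K) (p : K ⟶ G) (c : X ⟶ I) (v : I ⟶ Z),
      F.L v → F.L p → F.U c → F.U k →
      Nonempty (u ≫ h ≅ k ≫ p) → Nonempty (x ≫ a ≅ c ≫ v) →
      ∃ j : K ⟶ I, F.U j ∧ IsBipullback k e j c ∧ Nonempty (j ≫ v ⟶ p ≫ g)

/-- A span `X ⟵ apex ⟶ Y` in `S`. -/
structure BiSpan (X Y : S) where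
  apex : S
  left : apex ⟶ X
  right : apex ⟶ Y

/-- Two spans are isomorphic if there is an equivalence between their apexes that commutes with
both pairs of legs up to invertible 2-cells. -/
def BiSpan.Isomorphic {X Y : S} (p q : BiSpan X Y) : Prop :=
  ∃ e : p.apex ⟶ q.apex, IsEquivalence e ∧
    Nonempty (e ≫ q.left ≅ p.left) ∧ Nonempty (e ≫ q.right ≅ p.right)

theorem BiSpan.isomorphic_equivalence (X Y : S) :
    _root_.Equivalence (BiSpan.Isomorphic (X := X) (Y := Y)) where
  refl p := ⟨𝟙 _, ⟨𝟙 _, ⟨λ_ _⟩, ⟨λ_ _⟩⟩, ⟨λ_ _⟩, ⟨λ_ _⟩⟩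
  symm := by
    rintro p q ⟨e, ⟨g, ⟨η⟩, ⟨κ⟩⟩, ⟨l⟩, ⟨r⟩⟩
    exact ⟨g, ⟨e, ⟨κ⟩, ⟨η⟩⟩,
      ⟨whiskerLeftIso g l.symm ≪≫ (α_ _ _ _).symm ≪≫ whiskerRightIso κ _ ≪≫ λ_ _⟩,
      ⟨whiskerLeftIso g r.symm ≪≫ (α_ _ _ _).symm ≪≫ whiskerRightIso κ _ ≪≫ λ_ _⟩⟩
  trans := by
    rintro p q t ⟨e, ⟨g, ⟨η⟩, ⟨κ⟩⟩, ⟨l⟩, ⟨r⟩⟩ ⟨e', ⟨g', ⟨η'⟩, ⟨κ'⟩⟩, ⟨l'⟩, ⟨r'⟩⟩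
    exact ⟨e ≫ e', ⟨g' ≫ g,
        ⟨α_ _ _ _ ≪≫ whiskerLeftIso e ((α_ _ _ _).symm ≪≫ whiskerRightIso η' g ≪≫ λ_ g) ≪≫ η⟩,
        ⟨α_ _ _ _ ≪≫ whiskerLeftIso g' ((α_ _ _ _).symm ≪≫ whiskerRightIso κ e' ≪≫ λ_ e') ≪≫ κ'⟩⟩,
      ⟨α_ _ _ _ ≪≫ whiskerLeftIso e l' ≪≫ l⟩, ⟨α_ _ _ _ ≪≫ whiskerLeftIso e r' ≪≫ r⟩⟩

instance BiSpan.setoid (X Y : S) : Setoid (BiSpan X Y) :=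
  ⟨BiSpan.Isomorphic, BiSpan.isomorphic_equivalence X Y⟩

/-- Isomorphism classes of spans from `X` to `Y`. -/
def SpanClass (X Y : S) : Type (max u v) := Quotient (BiSpan.setoid X Y)

/-- The class of a span. -/
def SpanClass.mk {X Y : S} (p : BiSpan X Y) : SpanClass X Y := Quotient.mk _ p

/-- The identity span. -/
def BiSpan.id (X : S) : BiSpan X X := ⟨X, 𝟙 X, 𝟙 X⟩

/-- The data of the construction of a fake pullback of a cospan `r : O ⟶ W`, `s : V ⟶ W`:
factorizations `r ≅ x ∘ a` through `R` and `s ≅ y ∘ b` through `T`, a bipullback `Z` of `x` and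
`y`, squares with vertices `X` and `Y` as in condition V2 on `(a, y')` and on `(b, x')`, and a
bipullback `Q` of the resulting 1-cells `ab : X ⟶ Z` and `bb : Y ⟶ Z`. -/
structure FakePullback (F : FactorizationSystem S) {O V W : S} (r : O ⟶ W) (s : V ⟶ W) where
  {R T Z X Y Q : S}
  a : O ⟶ R
  x : R ⟶ W
  b : V ⟶ T
  y : T ⟶ W
  U_a : F.U a
  L_x : F.L x
  U_b : F.U b
  L_y : F.L y
  fac_r : a ≫ x ≅ r
  fac_s : b ≫ y ≅ s
  x' : Z ⟶ T
  y' : Z ⟶ R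
  L_x' : F.L x'
  L_y' : F.L y'
  bottom_right : IsBipullback x' y' y x
  ab : X ⟶ Z
  yb : X ⟶ O
  U_ab : F.U ab
  L_yb : F.L yb
  bottom_left : ab ≫ y' ⟶ yb ≫ a
  bb : Y ⟶ Z
  xb : Y ⟶ V
  U_bb : F.U bb
  L_xb : F.L xb
  top_right : bb ≫ x' ⟶ xb ≫ b
  a' : Q ⟶ Y
  b' : Q ⟶ X
  U_a' : F.U a'
  U_b' : F.U b'
  top_left : IsBipullback a' b' bb ab

/-- The fake pullback span `O ⟵ Q ⟶ V`. -/
def FakePullback.span {F : FactorizationSystem S} {O V W : S} {r : O ⟶ W} {s : V ⟶ W}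
    (D : FakePullback F r s) : BiSpan O V :=
  ⟨D.Q, D.b' ≫ D.yb, D.a' ≫ D.xb⟩

/-- The composite of the spans `p` and `q` formed with a given fake pullback of
`p.right` and `q.left`. -/
def FakePullback.composite {F : FactorizationSystem S} {X Y Z : S} {p : BiSpan X Y}
    {q : BiSpan Y Z} (D : FakePullback F p.right q.left) : BiSpan X Z :=
  ⟨D.span.apex, D.span.left ≫ p.left, D.span.right ≫ q.right⟩

/-- The type of objects of the category of spans in `S`: the objects of `S`. -/
structure Spn (S : Type u) where
  /-- The underlying object of `S`. -/
  obj : S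

/-- The objects of `S`, the isomorphism classes of spans, the classes of the identity spans, and a
given composition operation on classes of spans. -/
@[reducible]
def Spn.categoryStruct
    (comp : ∀ X Y Z : S, SpanClass X Y → SpanClass Y Z → SpanClass X Z) :
    CategoryStruct.{max u v} (Spn S) where
  Hom X Y := SpanClass X.obj Y.obj
  id X := SpanClass.mk (BiSpan.id X.obj)
  comp {X Y Z} f g := comp X.obj Y.obj Z.obj f g

end FakePullbacks

/-! Every condition involved asks only for the existence of 2-cells, and parallel 2-cells coincide.
So nothing is lost on passing to the category `Ho S` of isomorphism classes of 1-cells, whose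
hom-sets are partially ordered by the existence of a 2-cell. There equivalences become isomorphisms,
bipullbacks become pullbacks that also reflect the order, and isomorphism of spans becomes
isomorphism in an ordinary category. The argument is carried out in such an ordered category
(`OrderedReady`) and transported back by `FakePullbackReady.orderedReady`.

A fake pullback is a two-by-two grid: an `L`-pullback, two lax interchange squares and a
`U`-pullback. Each cell, like the two factorizations, is unique up to isomorphism, hence so is the
whole (`isFakePullback_unique`). This makes composition well defined.

Associativity comes from pasting (`isFakePullback_paste`). Two adjacent grids contain `U`-parts and
`L`-parts in the wrong order. Refactorizing the three middle composites and applying V3 and V4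
exchanges them, and the cells then merge into one grid. By symmetry, pasting works in the other
direction too, so a single fake pullback in the middle computes both bracketings of a triple
composite. -/

namespace FakePullbacks

/-! ### Fake pullbacks in categories enriched in partially ordered sets -/

section Ordered

variable {C : Type u} [Category.{v} C] [∀ X Y : C, PartialOrder (X ⟶ Y)]

/-- A commutative square that is a pullback for 1-cells and reflects the order of 1-cells. -/
structure IsOrderedPullback {P X Y Z : C} (p : P ⟶ X) (q : P ⟶ Y) (a : X ⟶ Z) (b : Y ⟶ Z) :
    Prop where
  w : p ≫ a = q ≫ b
  exists_lift : ∀ {K : C} (f : K ⟶ X) (g : K ⟶ Y), f ≫ a = g ≫ b →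
    ∃ k : K ⟶ P, k ≫ p = f ∧ k ≫ q = g
  le_of_le : ∀ {K : C} (k l : K ⟶ P), k ≫ p ≤ l ≫ p → k ≫ q ≤ l ≫ q → k ≤ l

/-- The locally posetal version of `FakePullbackReady`. -/
structure OrderedReady (U L : MorphismProperty C) : Prop where
  comp_mono : ∀ {X Y Z : C} {f f' : X ⟶ Y} {g g' : Y ⟶ Z}, f ≤ f' → g ≤ g' → f ≫ g ≤ f' ≫ g'
  U_of_isIso : ∀ {X Y : C} (f : X ⟶ Y) [IsIso f], U f
  L_of_isIso : ∀ {X Y : C} (f : X ⟶ Y) [IsIso f], L f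
  U_comp : ∀ {X Y Z : C} {f : X ⟶ Y} {g : Y ⟶ Z}, U f → U g → U (f ≫ g)
  L_comp : ∀ {X Y Z : C} {f : X ⟶ Y} {g : Y ⟶ Z}, L f → L g → L (f ≫ g)
  exists_diagonal : ∀ {X Y A B : C} {e : X ⟶ Y} {m : A ⟶ B}, U e → L m →
    ∀ (f : X ⟶ A) (g : Y ⟶ B), f ≫ m = e ≫ g → ∃ d : Y ⟶ A, e ≫ d = f ∧ d ≫ m = g
  diagonal_unique : ∀ {X Y A B : C} {e : X ⟶ Y} {m : A ⟶ B}, U e → L m →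
    ∀ d d' : Y ⟶ A, e ≫ d = e ≫ d' → d ≫ m = d' ≫ m → d = d'
  exists_factorization : ∀ {X Y : C} (f : X ⟶ Y),
    ∃ (I : C) (e : X ⟶ I) (m : I ⟶ Y), U e ∧ L m ∧ e ≫ m = f
  pullback_U : ∀ {X Y Z : C} (a : X ⟶ Z) (b : Y ⟶ Z), U a → U b →
    ∃ (P : C) (p : P ⟶ X) (q : P ⟶ Y), U p ∧ U q ∧ IsOrderedPullback p q a b
  pullback_L : ∀ {X Y Z : C} (x : X ⟶ Z) (y : Y ⟶ Z), L x → L y →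
    ∃ (P : C) (p : P ⟶ X) (q : P ⟶ Y), L p ∧ L q ∧ IsOrderedPullback p q x y
  exists_interchange : ∀ {X Y Z : C} (a : X ⟶ Z) (x : Y ⟶ Z), U a → L x →
    ∃ (T : C) (b : T ⟶ Y) (y : T ⟶ X), U b ∧ L y ∧ b ≫ x ≤ y ≫ a
  interchange_unique : ∀ {X Y Z : C} {a : X ⟶ Z} {x : Y ⟶ Z}, U a → L x →
    ∀ {T T' : C} {b : T ⟶ Y} {y : T ⟶ X} {b' : T' ⟶ Y} {y' : T' ⟶ X},
      U b → L y → b ≫ x ≤ y ≫ a → U b' → L y' → b' ≫ x ≤ y' ≫ a →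
      ∃ e : T ≅ T', e.hom ≫ b' = b ∧ e.hom ≫ y' = y
  shift_L : ∀ {X Y Z A B D : C} {x : X ⟶ Y} {r : X ⟶ A} {s : Y ⟶ B} {y : A ⟶ B}
    {a : Y ⟶ Z} {t : Z ⟶ D} {b : B ⟶ D},
    L r → L s → L t → L x → L y → U a → U b →
    IsOrderedPullback x r s y → a ≫ t ≤ s ≫ b →
    ∀ {I J : C} {c : X ⟶ I} {v : I ⟶ Z} {d : A ⟶ J} {w : J ⟶ D},
      L v → L w → U c → U d → x ≫ a = c ≫ v → y ≫ b = d ≫ w →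
      ∃ q : I ⟶ J, L q ∧ c ≫ q ≤ r ≫ d ∧ IsOrderedPullback v q t w
  shift_U : ∀ {D E G X Y Z : C} {u : D ⟶ E} {e : D ⟶ X} {f : E ⟶ Y} {x : X ⟶ Y}
    {h : E ⟶ G} {g : G ⟶ Z} {a : Y ⟶ Z},
    L x → L u → U h → U a → U e → U f → U g →
    IsOrderedPullback h f g a → e ≫ x ≤ u ≫ f →
    ∀ {K I : C} {k : D ⟶ K} {p : K ⟶ G} {c : X ⟶ I} {v : I ⟶ Z},
      L v → L p → U c → U k → u ≫ h = k ≫ p → x ≫ a = c ≫ v →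
      ∃ j : K ⟶ I, U j ∧ IsOrderedPullback k e j c ∧ j ≫ v ≤ p ≫ g

/-- The square with sides `p, q, r, s` is a fake pullback, formed with the factorizations `a ≫ x`
and `b ≫ y` of `r` and `s`. -/
def IsFakePullbackWith (U L : MorphismProperty C) {Q O V W R T : C} (p : Q ⟶ O) (q : Q ⟶ V)
    (a : O ⟶ R) (x : R ⟶ W) (b : V ⟶ T) (y : T ⟶ W) : Prop :=
  ∃ (Z X Y : C) (x' : Z ⟶ T) (y' : Z ⟶ R) (ab : X ⟶ Z) (yb : X ⟶ O) (bb : Y ⟶ Z) (xb : Y ⟶ V)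
    (a' : Q ⟶ Y) (b' : Q ⟶ X),
    (U a ∧ L x ∧ U b ∧ L y) ∧ (L x' ∧ L y' ∧ IsOrderedPullback x' y' y x) ∧
    (U ab ∧ L yb ∧ ab ≫ y' ≤ yb ≫ a) ∧ (U bb ∧ L xb ∧ bb ≫ x' ≤ xb ≫ b) ∧
    (U a' ∧ U b' ∧ IsOrderedPullback a' b' bb ab) ∧ b' ≫ yb = p ∧ a' ≫ xb = q

/-- The square with sides `p, q, r, s` is a fake pullback. -/
def IsFakePullback (U L : MorphismProperty C) {Q O V W : C} (p : Q ⟶ O) (q : Q ⟶ V)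
    (r : O ⟶ W) (s : V ⟶ W) : Prop :=
  ∃ (R T : C) (a : O ⟶ R) (x : R ⟶ W) (b : V ⟶ T) (y : T ⟶ W),
    a ≫ x = r ∧ b ≫ y = s ∧ IsFakePullbackWith U L p q a x b y

/-! ### Ordered pullbacks and factorizations: uniqueness and pasting. -/

theorem IsOrderedPullback.symm {P X Y Z : C} {p : P ⟶ X} {q : P ⟶ Y} {a : X ⟶ Z} {b : Y ⟶ Z}
    (h : IsOrderedPullback p q a b) : IsOrderedPullback q p b a where
  w := h.w.symm
  exists_lift f g w := by
    obtain ⟨k, hp, hq⟩ := h.exists_lift g f w.symm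
    exact ⟨k, hq, hp⟩
  le_of_le k l hq hp := h.le_of_le k l hp hq

theorem IsOrderedPullback.eq_of_eq {P X Y Z K : C} {p : P ⟶ X} {q : P ⟶ Y} {a : X ⟶ Z}
    {b : Y ⟶ Z} (h : IsOrderedPullback p q a b) {k l : K ⟶ P} (hp : k ≫ p = l ≫ p)
    (hq : k ≫ q = l ≫ q) : k = l :=
  le_antisymm (h.le_of_le _ _ hp.le hq.le) (h.le_of_le _ _ hp.ge hq.ge)

theorem IsOrderedPullback.exists_iso {P P' X Y Z : C} {p : P ⟶ X} {q : P ⟶ Y} {a : X ⟶ Z}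
    {b : Y ⟶ Z} {p' : P' ⟶ X} {q' : P' ⟶ Y} (h : IsOrderedPullback p q a b)
    (h' : IsOrderedPullback p' q' a b) : ∃ e : P ≅ P', e.hom ≫ p' = p ∧ e.hom ≫ q' = q := by
  obtain ⟨k, hp, hq⟩ := h'.exists_lift p q h.w
  obtain ⟨l, lp, lq⟩ := h.exists_lift p' q' h'.w
  exact ⟨⟨k, l, h.eq_of_eq (by simp [lp, hp]) (by simp [lq, hq]),
    h'.eq_of_eq (by simp [lp, hp]) (by simp [lq, hq])⟩, hp, hq⟩

theorem isOrderedPullback_id {X Z : C} (a : X ⟶ Z) : IsOrderedPullback a (𝟙 X) (𝟙 Z) a where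
  w := by simp
  exists_lift f g w := ⟨g, by simpa using w.symm, by simp⟩
  le_of_le k l _ h := by simpa using h

namespace OrderedReady

variable {U L : MorphismProperty C}

theorem le_comp_left (H : OrderedReady U L) {X Y Z : C} (f : X ⟶ Y) {g g' : Y ⟶ Z} (h : g ≤ g') :
    f ≫ g ≤ f ≫ g' := H.comp_mono le_rfl h

theorem le_comp_right (H : OrderedReady U L) {X Y Z : C} {f f' : X ⟶ Y} (h : f ≤ f') (g : Y ⟶ Z) :
    f ≫ g ≤ f' ≫ g := H.comp_mono h le_rfl

theorem pullback_paste (H : OrderedReady U L) {P X Y Z P₂ Y₂ : C} {p : P ⟶ X} {q : P ⟶ Y}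
    {a : X ⟶ Z} {b : Y ⟶ Z} {p₂ : P₂ ⟶ P} {q₂ : P₂ ⟶ Y₂} {b₂ : Y₂ ⟶ Y}
    (h : IsOrderedPullback p q a b) (h₂ : IsOrderedPullback p₂ q₂ q b₂) :
    IsOrderedPullback (p₂ ≫ p) q₂ a (b₂ ≫ b) where
  w := by rw [Category.assoc, h.w, ← Category.assoc, h₂.w, Category.assoc]
  exists_lift f g w := by
    obtain ⟨k, hp, hq⟩ := h.exists_lift f (g ≫ b₂) (by simpa using w)
    obtain ⟨l, lp, lq⟩ := h₂.exists_lift k g hq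
    exact ⟨l, by rw [← Category.assoc, lp, hp], lq⟩
  le_of_le k l hp hq := by
    -- Comparison over `X` and `Y₂` suffices: monotonicity of composition turns the inequality at
    -- `Y₂` into one at `Y`, so the first square already compares the maps into `P`.
    refine h₂.le_of_le k l (h.le_of_le _ _ (by simpa using hp) ?_) hq
    rw [Category.assoc, Category.assoc, h₂.w, ← Category.assoc, ← Category.assoc]
    exact H.le_comp_right hq b₂

theorem pullback_of_iso (H : OrderedReady U L) {P X Y Z X₁ Y₁ : C} {p : P ⟶ X} {q : P ⟶ Y}
    {a : X₁ ⟶ Z} {b : Y₁ ⟶ Z} (i : X ≅ X₁) (j : Y ≅ Y₁)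
    (h : IsOrderedPullback p q (i.hom ≫ a) (j.hom ≫ b)) :
    IsOrderedPullback (p ≫ i.hom) (q ≫ j.hom) a b where
  w := by simpa using h.w
  exists_lift f g w := by
    obtain ⟨k, hp, hq⟩ := h.exists_lift (f ≫ i.inv) (g ≫ j.inv) (by simpa using w)
    exact ⟨k, by rw [← Category.assoc, hp]; simp, by rw [← Category.assoc, hq]; simp⟩
  le_of_le k l hp hq := by
    refine h.le_of_le k l ?_ ?_
    · simpa using H.le_comp_right hp i.inv
    · simpa using H.le_comp_right hq j.inv

theorem factorization_unique (H : OrderedReady U L) {X Y I I' : C} {e : X ⟶ I} {m : I ⟶ Y}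
    {e' : X ⟶ I'} {m' : I' ⟶ Y} (he : U e) (hm : L m) (he' : U e') (hm' : L m')
    (h : e ≫ m = e' ≫ m') : ∃ i : I ≅ I', e ≫ i.hom = e' ∧ i.hom ≫ m' = m := by
  obtain ⟨k, hk, km⟩ := H.exists_diagonal he hm' e' m h.symm
  obtain ⟨l, hl, lm⟩ := H.exists_diagonal he' hm e m' h
  exact ⟨⟨k, l, H.diagonal_unique he hm _ _ (by simp [reassoc_of% hk, hl]) (by simp [km, lm]),
    H.diagonal_unique he' hm' _ _ (by simp [reassoc_of% hl, hk]) (by simp [km, lm])⟩, hk, km⟩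

/-! ### Existence, uniqueness and symmetry of fake pullbacks. -/

theorem exists_isFakePullback (H : OrderedReady U L) {O V W : C} (r : O ⟶ W) (s : V ⟶ W) :
    ∃ (Q : C) (p : Q ⟶ O) (q : Q ⟶ V), IsFakePullback U L p q r s := by
  obtain ⟨R, a, x, ha, hx, hr⟩ := H.exists_factorization r
  obtain ⟨T, b, y, hb, hy, hs⟩ := H.exists_factorization s
  obtain ⟨Z, x', y', hx', hy', hZ⟩ := H.pullback_L y x hy hx
  obtain ⟨X, ab, yb, hab, hyb, hX⟩ := H.exists_interchange a y' ha hy'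
  obtain ⟨Y, bb, xb, hbb, hxb, hY⟩ := H.exists_interchange b x' hb hx'
  obtain ⟨Q, a', b', ha', hb', hQ⟩ := H.pullback_U bb ab hbb hab
  exact ⟨Q, b' ≫ yb, a' ≫ xb, R, T, a, x, b, y, hr, hs, Z, X, Y, x', y', ab, yb, bb, xb, a', b',
    ⟨ha, hx, hb, hy⟩, ⟨hx', hy', hZ⟩, ⟨hab, hyb, hX⟩, ⟨hbb, hxb, hY⟩, ⟨ha', hb', hQ⟩, rfl, rfl⟩

/-- A fake pullback may be formed with any factorizations of the two sides of the cospan. -/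
theorem isFakePullbackWith (H : OrderedReady U L) {Q O V W R T : C} {p : Q ⟶ O}
    {q : Q ⟶ V} {a : O ⟶ R} {x : R ⟶ W} {b : V ⟶ T} {y : T ⟶ W}
    (h : IsFakePullback U L p q (a ≫ x) (b ≫ y)) (ha : U a) (hx : L x) (hb : U b) (hy : L y) :
    IsFakePullbackWith U L p q a x b y := by
  obtain ⟨R₀, T₀, a₀, x₀, b₀, y₀, hr, hs, Z, X, Y, x', y', ab, yb, bb, xb, a', b',
    ⟨ha₀, hx₀, hb₀, hy₀⟩, ⟨hx', hy', hZ⟩, ⟨hab, hyb, hX⟩, ⟨hbb, hxb, hY⟩, hQ⟩ := h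
  obtain ⟨i, rfl, rfl⟩ := H.factorization_unique ha₀ hx₀ ha hx hr
  obtain ⟨j, rfl, rfl⟩ := H.factorization_unique hb₀ hy₀ hb hy hs
  refine ⟨Z, X, Y, x' ≫ j.hom, y' ≫ i.hom, ab, yb, bb, xb, a', b', ⟨ha, hx, hb, hy⟩,
    ⟨H.L_comp hx' (H.L_of_isIso _), H.L_comp hy' (H.L_of_isIso _), H.pullback_of_iso j i hZ⟩,
    ⟨hab, hyb, ?_⟩, ⟨hbb, hxb, ?_⟩, hQ⟩
  · simpa using H.le_comp_right hX i.hom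
  · simpa using H.le_comp_right hY j.hom

theorem isFakePullback_unique (H : OrderedReady U L) {Q Q' O V W : C} {p : Q ⟶ O} {q : Q ⟶ V}
    {p' : Q' ⟶ O} {q' : Q' ⟶ V} {r : O ⟶ W} {s : V ⟶ W} (h : IsFakePullback U L p q r s)
    (h' : IsFakePullback U L p' q' r s) : ∃ e : Q ≅ Q', e.hom ≫ p' = p ∧ e.hom ≫ q' = q := by
  obtain ⟨R, T, a, x, b, y, rfl, rfl, Z, X, Y, x', y', ab, yb, bb, xb, a', b',
    ⟨ha, hx, hb, hy⟩, ⟨hx', hy', hZ⟩, ⟨hab, hyb, hX⟩, ⟨hbb, hxb, hY⟩, ⟨ha', hb', hQ⟩, rfl, rfl⟩ := h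
  obtain ⟨Z₁, X₁, Y₁, x₁', y₁', ab₁, yb₁, bb₁, xb₁, a₁', b₁', -,
    ⟨hx₁', hy₁', hZ₁⟩, ⟨hab₁, hyb₁, hX₁⟩, ⟨hbb₁, hxb₁, hY₁⟩, ⟨ha₁', hb₁', hQ₁⟩, rfl, rfl⟩ :=
    H.isFakePullbackWith h' ha hx hb hy
  obtain ⟨k, rfl, rfl⟩ := hZ.exists_iso hZ₁
  -- Composing `ab` with the isomorphism `k` turns the first interchange square into one over `y₁'`,
  -- so that V2 can compare it with the second.
  obtain ⟨e, he, rfl⟩ := H.interchange_unique ha hy₁' (H.U_comp hab (H.U_of_isIso k.hom)) hyb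
    (by simpa using hX) hab₁ hyb₁ hX₁
  obtain ⟨f, hf, rfl⟩ := H.interchange_unique hb hx₁' (H.U_comp hbb (H.U_of_isIso k.hom)) hxb
    (by simpa using hY) hbb₁ hxb₁ hY₁
  -- `Q` remains a pullback after its cospan is carried from `Z` to `Z₁` along the isomorphism `k`.
  have hQ' : IsOrderedPullback a' b' (f.hom ≫ bb₁) (e.hom ≫ ab₁) := by
    rw [hf, he]
    refine ⟨by rw [← Category.assoc, hQ.w, Category.assoc], fun g g' w => ?_, hQ.le_of_le⟩
    exact hQ.exists_lift g g' (by simpa [← Category.assoc] using w)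
  obtain ⟨g, ga, gb⟩ := (H.pullback_of_iso f e hQ').exists_iso hQ₁
  exact ⟨g, by rw [reassoc_of% gb], by rw [reassoc_of% ga]⟩

theorem isFakePullback_symm {Q O V W : C} {p : Q ⟶ O} {q : Q ⟶ V} {r : O ⟶ W} {s : V ⟶ W}
    (h : IsFakePullback U L p q r s) : IsFakePullback U L q p s r := by
  obtain ⟨R, T, a, x, b, y, hr, hs, Z, X, Y, x', y', ab, yb, bb, xb, a', b',
    ⟨ha, hx, hb, hy⟩, ⟨hx', hy', hZ⟩, hX, hY, ⟨ha', hb', hQ⟩, hp, hq⟩ := h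
  exact ⟨T, R, b, y, a, x, hs, hr, Z, Y, X, y', x', bb, xb, ab, yb, b', a', ⟨hb, hy, ha, hx⟩,
    ⟨hy', hx', hZ.symm⟩, hY, hX, ⟨hb', ha', hQ.symm⟩, hq, hp⟩

theorem isFakePullback_of_iso (H : OrderedReady U L) {Q O V W O₁ V₁ : C} {p : Q ⟶ O} {q : Q ⟶ V}
    {r : O₁ ⟶ W} {s : V₁ ⟶ W} (i : O ≅ O₁) (j : V ≅ V₁)
    (h : IsFakePullback U L p q (i.hom ≫ r) (j.hom ≫ s)) :
    IsFakePullback U L (p ≫ i.hom) (q ≫ j.hom) r s := by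
  obtain ⟨R, T, a, x, b, y, hr, hs, Z, X, Y, x', y', ab, yb, bb, xb, a', b',
    ⟨ha, hx, hb, hy⟩, hZ, ⟨hab, hyb, hX⟩, ⟨hbb, hxb, hY⟩, hQ, rfl, rfl⟩ := h
  exact ⟨R, T, i.inv ≫ a, x, j.inv ≫ b, y, by simp [hr], by simp [hs], Z, X, Y, x', y', ab,
    yb ≫ i.hom, bb, xb ≫ j.hom, a', b',
    ⟨H.U_comp (H.U_of_isIso _) ha, hx, H.U_comp (H.U_of_isIso _) hb, hy⟩, hZ,
    ⟨hab, H.L_comp hyb (H.L_of_isIso _), by simpa using hX⟩,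
    ⟨hbb, H.L_comp hxb (H.L_of_isIso _), by simpa using hY⟩, hQ, by simp, by simp⟩

/-! ### Units, pasting and associativity. -/

theorem isFakePullback_id (H : OrderedReady U L) {O W : C} (r : O ⟶ W) :
    IsFakePullback U L (𝟙 O) r r (𝟙 W) := by
  obtain ⟨R, a, x, ha, hx, rfl⟩ := H.exists_factorization r
  -- With the trivial factorization of the identity, the grid is `a` followed by `x` with identities
  -- across, and all four cells commute.
  exact ⟨R, W, a, x, 𝟙 W, 𝟙 W, rfl, by simp, R, O, R, x, 𝟙 R, a, 𝟙 O, 𝟙 R, x, a, 𝟙 O,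
    ⟨ha, hx, H.U_of_isIso _, H.L_of_isIso _⟩, ⟨hx, H.L_of_isIso _, isOrderedPullback_id x⟩,
    ⟨ha, H.L_of_isIso _, by simp⟩, ⟨H.U_of_isIso _, hx, by simp⟩,
    ⟨ha, H.U_of_isIso _, isOrderedPullback_id a⟩, by simp, rfl⟩

/-- The two grids share the factorization `a' ≫ xb` of `q`. On the far side, `s₂ ≫ s` appears as a
word of type `U`, `L`, `U`, `L`; factorizing its middle part brings it to `U` followed by `L`. The
same is done to the two parallel rows. -/
theorem isFakePullback_paste (H : OrderedReady U L) {Q O V W Q₂ V₂ : C} {p : Q ⟶ O} {q : Q ⟶ V}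
    {r : O ⟶ W} {s : V ⟶ W} {p₂ : Q₂ ⟶ Q} {q₂ : Q₂ ⟶ V₂} {s₂ : V₂ ⟶ V}
    (h : IsFakePullback U L p q r s) (h₂ : IsFakePullback U L p₂ q₂ q s₂) :
    IsFakePullback U L (p₂ ≫ p) q₂ r (s₂ ≫ s) := by
  obtain ⟨R, T, a, x, b, y, rfl, rfl, Z, X, Y, x', y', ab, yb, bb, xb, a', b',
    ⟨ha, hx, hb, hy⟩, ⟨hx', hy', hZ⟩, ⟨hab, hyb, hX⟩, ⟨hbb, hxb, hY⟩, ⟨ha', hb', hQ⟩, rfl, rfl⟩ := h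
  obtain ⟨T₂, b₂, y₂, hb₂, hy₂, rfl⟩ := H.exists_factorization s₂
  obtain ⟨Z₂, X₂, Y₂, x₂', y₂', ab₂, yb₂, bb₂, xb₂, a₂', b₂', -,
    ⟨hx₂', hy₂', hZ₂⟩, ⟨hab₂, hyb₂, hX₂⟩, ⟨hbb₂, hxb₂, hY₂⟩, ⟨ha₂', hb₂', hQ₂⟩, rfl, rfl⟩ :=
    H.isFakePullbackWith h₂ ha' hxb hb₂ hy₂
  obtain ⟨J, c, w, hc, hw, hJ⟩ := H.exists_factorization (y₂ ≫ b)
  obtain ⟨I, c₁, v₁, hc₁, hv₁, hI⟩ := H.exists_factorization (y₂' ≫ bb)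
  obtain ⟨K, c₂, v₂, hc₂, hv₂, hK⟩ := H.exists_factorization (yb₂ ≫ b')
  -- V3 moves the `L`-pullback `Z₂` past the interchange square `Y`. The resulting pullback `I` is
  -- adjacent to `Z`.
  obtain ⟨g, hg, hcg, hIJ⟩ := H.shift_L hx₂' hxb hx' hy₂' hy₂ hbb hb hZ₂.symm hY hv₁ hw hc₁ hc
    hI.symm hJ.symm
  -- V4 moves the interchange square `X₂` past the `U`-pullback `Q`. The resulting pullback has
  -- vertex `X₂` and is adjacent to `Q₂`.
  obtain ⟨j, hj, hKI, hjv⟩ := H.shift_U hy₂' hyb₂ hb' hbb hab₂ ha' hab hQ.symm hX₂ hv₁ hv₂ hc₁ hc₂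
    hK.symm hI.symm
  refine ⟨R, J, a, x, b₂ ≫ c, w ≫ y, rfl, by simp [reassoc_of% hJ], I, K, Y₂, g, v₁ ≫ y', j,
    v₂ ≫ yb, bb₂ ≫ c₁, xb₂, a₂', b₂' ≫ c₂, ⟨ha, hx, H.U_comp hb₂ hc, H.L_comp hw hy⟩,
    ⟨hg, H.L_comp hv₁ hy', (H.pullback_paste hZ.symm hIJ).symm⟩, ⟨hj, H.L_comp hv₂ hyb, ?_⟩,
    ⟨H.U_comp hbb₂ hc₁, hxb₂, ?_⟩,
    ⟨ha₂', H.U_comp hb₂' hc₂, (H.pullback_paste hKI hQ₂.symm).symm⟩, ?_, rfl⟩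
  · calc j ≫ v₁ ≫ y' ≤ v₂ ≫ ab ≫ y' := by simpa using H.le_comp_right hjv y'
      _ ≤ (v₂ ≫ yb) ≫ a := by simpa using H.le_comp_left v₂ hX
  · calc (bb₂ ≫ c₁) ≫ g ≤ bb₂ ≫ x₂' ≫ c := by simpa using H.le_comp_left bb₂ hcg
      _ ≤ xb₂ ≫ b₂ ≫ c := by simpa using H.le_comp_right hY₂ c
  · simp [reassoc_of% hK]

/-- The two ways to compose three spans by fake pullbacks agree. -/
theorem isFakePullback_assoc (H : OrderedReady U L) {X Y A B D Q Q' P P' : C} {r : A ⟶ X}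
    {s : B ⟶ X} {t : B ⟶ Y} {m : D ⟶ Y} {p : Q ⟶ A} {q : Q ⟶ B} {p' : Q' ⟶ B} {q' : Q' ⟶ D}
    {f : P ⟶ Q} {g : P ⟶ D} {f' : P' ⟶ A} {g' : P' ⟶ Q'}
    (h : IsFakePullback U L p q r s) (h' : IsFakePullback U L p' q' t m)
    (k : IsFakePullback U L f g (q ≫ t) m) (k' : IsFakePullback U L f' g' r (p' ≫ s)) :
    ∃ e : P ≅ P', e.hom ≫ f' = f ≫ p ∧ e.hom ≫ g' ≫ q' = g := by
  -- `N` pasted with the `Q'` square is a fake pullback of the same cospan as `P`; pasted with the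
  -- `Q` square, of the same cospan as `P'`.
  obtain ⟨N, n, n', hN⟩ := H.exists_isFakePullback q p'
  obtain ⟨e, rfl, rfl⟩ := H.isFakePullback_unique k (isFakePullback_symm
    (H.isFakePullback_paste (isFakePullback_symm h') (isFakePullback_symm hN)))
  obtain ⟨i, hi, rfl⟩ := H.isFakePullback_unique (H.isFakePullback_paste h hN) k'
  exact ⟨e ≪≫ i, by simp [hi], by simp⟩

end OrderedReady

end Ordered

end FakePullbacks

namespace FakePullbacks

/-! ### The homotopy category of a bicategory -/

section Homotopy

/-- The objects of `S`, as objects of the category whose morphisms are the isomorphism classes of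
1-cells of `S`. -/
structure Ho (S : Type u) where
  /-- The underlying object of `S`. -/
  obj : S

variable {S : Type u} [Bicategory.{w, v} S]

instance : Category (Ho S) where
  Hom X Y := ThinSkeleton (X.obj ⟶ Y.obj)
  id X := ThinSkeleton.mk (𝟙 X.obj)
  comp {X Y Z} := Quotient.map₂ (· ≫ ·)
    fun _ _ ⟨i⟩ _ _ ⟨j⟩ => ⟨whiskerRightIso i _ ≪≫ whiskerLeftIso _ j⟩
  id_comp := by
    rintro X Y ⟨f⟩
    exact Quotient.sound ⟨λ_ f⟩
  comp_id := by
    rintro X Y ⟨f⟩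
    exact Quotient.sound ⟨ρ_ f⟩
  assoc := by
    rintro X Y Z W ⟨f⟩ ⟨g⟩ ⟨h⟩
    exact Quotient.sound ⟨α_ f g h⟩

/-- The isomorphism class of a 1-cell. -/
def Ho.hom {X Y : S} (f : X ⟶ Y) : (⟨X⟩ : Ho S) ⟶ ⟨Y⟩ := ThinSkeleton.mk f

theorem Ho.hom_surjective {X Y : S} (f : (⟨X⟩ : Ho S) ⟶ ⟨Y⟩) : ∃ g : X ⟶ Y, Ho.hom g = f :=
  Quotient.exists_rep f

theorem Ho.hom_eq_iff {X Y : S} {f g : X ⟶ Y} : Ho.hom f = Ho.hom g ↔ Nonempty (f ≅ g) :=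
  ⟨fun h => Quotient.exact h, fun h => Quotient.sound h⟩

theorem Ho.isIso_hom_iff {X Y : S} {f : X ⟶ Y} : IsIso (Ho.hom f) ↔ IsEquivalence f := by
  constructor
  · rintro ⟨g, h, h'⟩
    obtain ⟨g, rfl⟩ := Ho.hom_surjective g
    exact ⟨g, Ho.hom_eq_iff.1 h, Ho.hom_eq_iff.1 h'⟩
  · rintro ⟨g, h, h'⟩
    exact ⟨Ho.hom g, Ho.hom_eq_iff.2 h, Ho.hom_eq_iff.2 h'⟩

/-- The morphisms of the homotopy category that are represented by a member of a class of
1-cells. -/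
def Ho.property (P : MorphismProperty S) : MorphismProperty (Ho S) :=
  fun X Y f => ∃ g : X.obj ⟶ Y.obj, P g ∧ Ho.hom g = f

/-- Existence is needed in `S` itself, since a `FakePullback` consists of actual 1-cells and not of
their classes. -/
theorem FakePullbackReady.nonempty_fakePullback {F : FactorizationSystem S}
    (hF : FakePullbackReady F) {O V W : S}
    (r : O ⟶ W) (s : V ⟶ W) : Nonempty (FakePullback F r s) := by
  obtain ⟨R, a, x, ha, hx, ⟨hr⟩⟩ := F.exists_factorization r
  obtain ⟨T, b, y, hb, hy, ⟨hs⟩⟩ := F.exists_factorization s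
  obtain ⟨Z, x', y', hx', hy', hZ⟩ := hF.bipullback_L y x hy hx
  obtain ⟨X, ab, yb, hab, hyb, ⟨hX⟩⟩ := hF.exists_interchange a y' ha hy'
  obtain ⟨Y, bb, xb, hbb, hxb, ⟨hY⟩⟩ := hF.exists_interchange b x' hb hx'
  obtain ⟨Q, a', b', ha', hb', hQ⟩ := hF.bipullback_U bb ab hbb hab
  exact ⟨⟨a, x, b, y, ha, hx, hb, hy, hr, hs, x', y', hx', hy', hZ, ab, yb, hab, hyb, hX, bb, xb,
    hbb, hxb, hY, a', b', ha', hb', hQ⟩⟩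

theorem SpanClass.mk_eq_iff {X Y : S} {p q : BiSpan X Y} :
    SpanClass.mk p = SpanClass.mk q ↔ ∃ e : (⟨p.apex⟩ : Ho S) ≅ ⟨q.apex⟩,
      e.hom ≫ Ho.hom q.left = Ho.hom p.left ∧ e.hom ≫ Ho.hom q.right = Ho.hom p.right := by
  constructor
  · intro h
    obtain ⟨e, he, l, r⟩ : p.Isomorphic q := Quotient.exact h
    have := Ho.isIso_hom_iff.2 he
    exact ⟨asIso (Ho.hom e), Ho.hom_eq_iff.2 l, Ho.hom_eq_iff.2 r⟩
  · rintro ⟨e, l, r⟩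
    obtain ⟨f, hf⟩ := Ho.hom_surjective e.hom
    rw [← hf] at l r
    exact Quotient.sound ⟨f, Ho.isIso_hom_iff.1 (hf ▸ inferInstance), Ho.hom_eq_iff.1 l,
      Ho.hom_eq_iff.1 r⟩

/-! ### The order on isomorphism classes and the transfer of the axioms. -/

variable [∀ X Y : S, Quiver.IsThin (X ⟶ Y)]

/-- Antisymmetry uses local preorderedness: 2-cells in both directions are mutually inverse. -/
instance (X Y : Ho S) : PartialOrder (X ⟶ Y) :=
  inferInstanceAs (PartialOrder (ThinSkeleton (X.obj ⟶ Y.obj)))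

/-- A functor to an iso-comma category with thin components is an equivalence if it is
essentially surjective and full. -/
theorem isEquivalence_categoricalPullback {A B D E : Type*} [Category A] [Category B]
    [Category D] [Category E] [Quiver.IsThin A] [Quiver.IsThin B] [Quiver.IsThin D]
    [Quiver.IsThin E] {F : A ⥤ B} {G : D ⥤ B} (T : E ⥤ CategoricalPullback F G) :
    T.IsEquivalence ↔
      (∀ (a : A) (d : D), Nonempty (F.obj a ≅ G.obj d) →
        ∃ e : E, Nonempty ((T.obj e).fst ≅ a) ∧ Nonempty ((T.obj e).snd ≅ d)) ∧
      ∀ e e' : E, Nonempty ((T.obj e).fst ⟶ (T.obj e').fst) →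
        Nonempty ((T.obj e).snd ⟶ (T.obj e').snd) → Nonempty (e ⟶ e') := by
  constructor
  · intro h
    refine ⟨fun a d ⟨i⟩ => ?_, fun e e' ⟨f⟩ ⟨g⟩ => ⟨T.preimage ⟨f, g, Subsingleton.elim _ _⟩⟩⟩
    let j := T.objObjPreimageIso ⟨a, d, i⟩
    exact ⟨T.objPreimage ⟨a, d, i⟩, ⟨(CategoricalPullback.π₁ F G).mapIso j⟩,
      ⟨(CategoricalPullback.π₂ F G).mapIso j⟩⟩
  · rintro ⟨h, h'⟩
    exact
      { faithful := ⟨fun _ => Subsingleton.elim _ _⟩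
        full := ⟨fun {e e'} f => ⟨(h' e e' ⟨f.fst⟩ ⟨f.snd⟩).some,
          CategoricalPullback.hom_ext (Subsingleton.elim _ _) (Subsingleton.elim _ _)⟩⟩
        essSurj := ⟨fun x => by
          obtain ⟨e, ⟨i⟩, ⟨j⟩⟩ := h x.fst x.snd ⟨x.iso⟩
          exact ⟨e, ⟨CategoricalPullback.mkIso i j (Subsingleton.elim _ _)⟩⟩⟩ }

/-- Essential surjectivity of the comparison functor is the existence of lifts, fullness is order
reflection, and faithfulness is automatic. The choice of the invertible 2-cell is immaterial. -/
theorem isOrderedPullback_hom_iff {P X Y Z : S} {p : P ⟶ X} {q : P ⟶ Y} {a : X ⟶ Z} {b : Y ⟶ Z} :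
    IsOrderedPullback (Ho.hom p) (Ho.hom q) (Ho.hom a) (Ho.hom b) ↔ IsBipullback p q a b := by
  constructor
  · intro h
    obtain ⟨α⟩ := Ho.hom_eq_iff.1 h.w
    refine ⟨α, fun K => (isEquivalence_categoricalPullback _).2
      ⟨fun f g i => ?_, fun k l hp hq => h.le_of_le (Ho.hom k) (Ho.hom l) hp hq⟩⟩
    obtain ⟨k, hp, hq⟩ := h.exists_lift (Ho.hom f) (Ho.hom g) (Ho.hom_eq_iff.2 i)
    obtain ⟨k, rfl⟩ := Ho.hom_surjective k
    exact ⟨k, Ho.hom_eq_iff.1 hp, Ho.hom_eq_iff.1 hq⟩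
  · rintro ⟨α, h⟩
    refine ⟨Ho.hom_eq_iff.2 ⟨α⟩, ?_, ?_⟩
    · rintro K ⟨f⟩ ⟨g⟩ w
      obtain ⟨k, hp, hq⟩ :=
        ((isEquivalence_categoricalPullback _).1 (h K.obj)).1 f g (Ho.hom_eq_iff.1 w)
      exact ⟨Ho.hom k, Ho.hom_eq_iff.2 hp, Ho.hom_eq_iff.2 hq⟩
    · rintro K ⟨k⟩ ⟨l⟩ hp hq
      exact ((isEquivalence_categoricalPullback _).1 (h K.obj)).2 k l hp hq

variable {F : FactorizationSystem S}

/-- Every morphism in one of the two classes has a representative in the corresponding class of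
1-cells, so each axiom is applied to representatives. -/
theorem FakePullbackReady.orderedReady (hF : FakePullbackReady F) :
    OrderedReady (Ho.property F.U) (Ho.property F.L) where
  comp_mono := by
    rintro X Y Z ⟨f⟩ ⟨f'⟩ ⟨g⟩ ⟨g'⟩ ⟨s⟩ ⟨t⟩
    exact ⟨s ▷ g ≫ f' ◁ t⟩
  U_of_isIso := by
    rintro X Y ⟨f⟩ h
    exact ⟨f, F.U_of_isEquivalence f (Ho.isIso_hom_iff.1 h), rfl⟩
  L_of_isIso := by
    rintro X Y ⟨f⟩ h
    exact ⟨f, F.L_of_isEquivalence f (Ho.isIso_hom_iff.1 h), rfl⟩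
  U_comp := by
    rintro X Y Z _ _ ⟨f, hf, rfl⟩ ⟨g, hg, rfl⟩
    exact ⟨f ≫ g, F.U_comp f g hf hg, rfl⟩
  L_comp := by
    rintro X Y Z _ _ ⟨f, hf, rfl⟩ ⟨g, hg, rfl⟩
    exact ⟨f ≫ g, F.L_comp f g hf hg, rfl⟩
  exists_diagonal := by
    rintro X Y A B _ _ ⟨e, he, rfl⟩ ⟨m, hm, rfl⟩ ⟨f⟩ ⟨g⟩ w
    obtain ⟨d, h, h'⟩ := ((isEquivalence_categoricalPullback _).1 (F.orthogonal e m he hm)).1 f g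
      (Ho.hom_eq_iff.1 w)
    exact ⟨Ho.hom d, Ho.hom_eq_iff.2 h, Ho.hom_eq_iff.2 h'⟩
  diagonal_unique := by
    rintro X Y A B _ _ ⟨e, he, rfl⟩ ⟨m, hm, rfl⟩ ⟨d⟩ ⟨d'⟩ h h'
    have H := ((isEquivalence_categoricalPullback _).1 (F.orthogonal e m he hm)).2
    -- Fullness of the comparison functor gives a 2-cell in each direction.
    exact le_antisymm (H d d' h.le h'.le) (H d' d h.ge h'.ge)
  exists_factorization := by
    rintro X Y ⟨f⟩
    obtain ⟨I, e, m, he, hm, h⟩ := F.exists_factorization f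
    exact ⟨⟨I⟩, Ho.hom e, Ho.hom m, ⟨e, he, rfl⟩, ⟨m, hm, rfl⟩, Ho.hom_eq_iff.2 h⟩
  pullback_U := by
    rintro X Y Z _ _ ⟨a, ha, rfl⟩ ⟨b, hb, rfl⟩
    obtain ⟨P, p, q, hp, hq, h⟩ := hF.bipullback_U a b ha hb
    exact ⟨⟨P⟩, Ho.hom p, Ho.hom q, ⟨p, hp, rfl⟩, ⟨q, hq, rfl⟩, isOrderedPullback_hom_iff.2 h⟩
  pullback_L := by
    rintro X Y Z _ _ ⟨a, ha, rfl⟩ ⟨b, hb, rfl⟩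
    obtain ⟨P, p, q, hp, hq, h⟩ := hF.bipullback_L a b ha hb
    exact ⟨⟨P⟩, Ho.hom p, Ho.hom q, ⟨p, hp, rfl⟩, ⟨q, hq, rfl⟩, isOrderedPullback_hom_iff.2 h⟩
  exists_interchange := by
    rintro X Y Z _ _ ⟨a, ha, rfl⟩ ⟨x, hx, rfl⟩
    obtain ⟨T, b, y, hb, hy, h⟩ := hF.exists_interchange a x ha hx
    exact ⟨⟨T⟩, Ho.hom b, Ho.hom y, ⟨b, hb, rfl⟩, ⟨y, hy, rfl⟩, h⟩
  interchange_unique := by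
    rintro X Y Z _ _ ⟨a, ha, rfl⟩ ⟨x, hx, rfl⟩ T T' _ _ _ _ ⟨b, hb, rfl⟩ ⟨y, hy, rfl⟩ h
      ⟨b', hb', rfl⟩ ⟨y', hy', rfl⟩ h'
    obtain ⟨e, he, i, j⟩ := hF.interchange_unique a x ha hx b y b' y' hb hy h hb' hy' h'
    have := Ho.isIso_hom_iff.2 he
    exact ⟨asIso (Ho.hom e), Ho.hom_eq_iff.2 i, Ho.hom_eq_iff.2 j⟩
  shift_L := by
    rintro X Y Z A B D _ _ _ _ _ _ _ ⟨r, hr, rfl⟩ ⟨s, hs, rfl⟩ ⟨t, ht, rfl⟩ ⟨x, hx, rfl⟩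
      ⟨y, hy, rfl⟩ ⟨a, ha, rfl⟩ ⟨b, hb, rfl⟩ h l I J _ _ _ _ ⟨v, hv, rfl⟩ ⟨w, hw, rfl⟩ ⟨c, hc, rfl⟩
      ⟨d, hd, rfl⟩ i j
    obtain ⟨q, hq, k, hq'⟩ := hF.shift_L x r s y a t b hr hs ht hx hy ha hb
      (isOrderedPullback_hom_iff.1 h) l c v d w hv hw hc hd (Ho.hom_eq_iff.1 i) (Ho.hom_eq_iff.1 j)
    exact ⟨Ho.hom q, ⟨q, hq, rfl⟩, k, isOrderedPullback_hom_iff.2 hq'⟩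
  shift_U := by
    rintro D E G X Y Z _ _ _ _ _ _ _ ⟨x, hx, rfl⟩ ⟨u, hu, rfl⟩ ⟨h, hh, rfl⟩ ⟨a, ha, rfl⟩
      ⟨e, he, rfl⟩ ⟨f, hf, rfl⟩ ⟨g, hg, rfl⟩ t l K I _ _ _ _ ⟨v, hv, rfl⟩ ⟨p, hp, rfl⟩ ⟨c, hc, rfl⟩
      ⟨k, hk, rfl⟩ i j
    obtain ⟨q, hq, hq', m⟩ := hF.shift_U u e f x h g a hx hu hh ha he hf hg
      (isOrderedPullback_hom_iff.1 t) l k p c v hv hp hc hk (Ho.hom_eq_iff.1 i) (Ho.hom_eq_iff.1 j)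
    exact ⟨Ho.hom q, ⟨q, hq, rfl⟩, isOrderedPullback_hom_iff.2 hq', m⟩

/-! ### Composition of spans -/

theorem FakePullback.isFakePullback {O V W : S} {r : O ⟶ W} {s : V ⟶ W}
    (D : FakePullback F r s) :
    IsFakePullback (Ho.property F.U) (Ho.property F.L) (Ho.hom D.span.left) (Ho.hom D.span.right)
      (Ho.hom r) (Ho.hom s) :=
  ⟨⟨D.R⟩, ⟨D.T⟩, Ho.hom D.a, Ho.hom D.x, Ho.hom D.b, Ho.hom D.y, Ho.hom_eq_iff.2 ⟨D.fac_r⟩,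
    Ho.hom_eq_iff.2 ⟨D.fac_s⟩, ⟨D.Z⟩, ⟨D.X⟩, ⟨D.Y⟩, Ho.hom D.x', Ho.hom D.y', Ho.hom D.ab, Ho.hom D.yb,
    Ho.hom D.bb, Ho.hom D.xb, Ho.hom D.a', Ho.hom D.b',
    ⟨⟨_, D.U_a, rfl⟩, ⟨_, D.L_x, rfl⟩, ⟨_, D.U_b, rfl⟩, ⟨_, D.L_y, rfl⟩⟩,
    ⟨⟨_, D.L_x', rfl⟩, ⟨_, D.L_y', rfl⟩, isOrderedPullback_hom_iff.2 D.bottom_right⟩,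
    ⟨⟨_, D.U_ab, rfl⟩, ⟨_, D.L_yb, rfl⟩, ⟨D.bottom_left⟩⟩,
    ⟨⟨_, D.U_bb, rfl⟩, ⟨_, D.L_xb, rfl⟩, ⟨D.top_right⟩⟩,
    ⟨⟨_, D.U_a', rfl⟩, ⟨_, D.U_b', rfl⟩, isOrderedPullback_hom_iff.2 D.top_left⟩, rfl, rfl⟩

/-- This gives at once independence of the representing spans and of the chosen fake pullback: the
first fake pullback is transported along the two span isomorphisms and compared with the second. -/
theorem FakePullbackReady.mk_composite_eq (hF : FakePullbackReady F) {X Y Z : S}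
    {p p' : BiSpan X Y} {q q' : BiSpan Y Z} (hp : SpanClass.mk p = SpanClass.mk p')
    (hq : SpanClass.mk q = SpanClass.mk q') (D : FakePullback F p.right q.left)
    (D' : FakePullback F p'.right q'.left) :
    SpanClass.mk D.composite = SpanClass.mk D'.composite := by
  obtain ⟨i, il, ir⟩ := SpanClass.mk_eq_iff.1 hp
  obtain ⟨j, jl, jr⟩ := SpanClass.mk_eq_iff.1 hq
  have h := D.isFakePullback
  rw [← ir, ← jl] at h
  obtain ⟨e, el, er⟩ := hF.orderedReady.isFakePullback_unique
    (hF.orderedReady.isFakePullback_of_iso i j h) D'.isFakePullback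
  refine SpanClass.mk_eq_iff.2 ⟨e, ?_, ?_⟩
  -- The class of a composite 1-cell is by definition the composite of the classes.
  · change e.hom ≫ Ho.hom D'.span.left ≫ Ho.hom p'.left = Ho.hom D.span.left ≫ Ho.hom p.left
    rw [reassoc_of% el, il]
  · change e.hom ≫ Ho.hom D'.span.right ≫ Ho.hom q'.right = Ho.hom D.span.right ≫ Ho.hom q.right
    rw [reassoc_of% er, jr]

theorem FakePullbackReady.mk_composite_id_left (hF : FakePullbackReady F) {X Y : S}
    (p : BiSpan X Y) (D : FakePullback F (BiSpan.id X).right p.left) :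
    SpanClass.mk D.composite = SpanClass.mk p := by
  obtain ⟨e, el, er⟩ := hF.orderedReady.isFakePullback_unique D.isFakePullback
    (OrderedReady.isFakePullback_symm (hF.orderedReady.isFakePullback_id (Ho.hom p.left)))
  refine SpanClass.mk_eq_iff.2 ⟨e, el.trans (Category.comp_id (Ho.hom D.span.left)).symm, ?_⟩
  change e.hom ≫ Ho.hom p.right = Ho.hom D.span.right ≫ Ho.hom p.right
  rw [← er, Category.comp_id]

theorem FakePullbackReady.mk_composite_id_right (hF : FakePullbackReady F) {X Y : S}
    (p : BiSpan X Y) (D : FakePullback F p.right (BiSpan.id Y).left) :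
    SpanClass.mk D.composite = SpanClass.mk p := by
  obtain ⟨e, el, er⟩ := hF.orderedReady.isFakePullback_unique D.isFakePullback
    (hF.orderedReady.isFakePullback_id (Ho.hom p.right))
  refine SpanClass.mk_eq_iff.2 ⟨e, ?_, er.trans (Category.comp_id (Ho.hom D.span.right)).symm⟩
  change e.hom ≫ Ho.hom p.left = Ho.hom D.span.left ≫ Ho.hom p.left
  rw [← el, Category.comp_id]

theorem FakePullbackReady.mk_composite_assoc (hF : FakePullbackReady F) {X Y Z W : S}
    {p : BiSpan X Y} {q : BiSpan Y Z} {t : BiSpan Z W} (D : FakePullback F p.right q.left)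
    (E : FakePullback F q.right t.left) (D' : FakePullback F D.composite.right t.left)
    (E' : FakePullback F p.right E.composite.left) :
    SpanClass.mk D'.composite = SpanClass.mk E'.composite := by
  obtain ⟨e, el, er⟩ := hF.orderedReady.isFakePullback_assoc D.isFakePullback E.isFakePullback
    D'.isFakePullback E'.isFakePullback
  have hl := el =≫ Ho.hom p.left
  have hr := er =≫ Ho.hom t.right
  exact SpanClass.mk_eq_iff.2 ⟨e,
    (Category.assoc _ _ _).symm.trans
      (hl.trans (Category.assoc (Ho.hom D'.span.left) (Ho.hom D.span.left) (Ho.hom p.left))),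
    (e.hom ≫= (Category.assoc (Ho.hom E'.span.right) (Ho.hom E.span.right)
      (Ho.hom t.right)).symm).trans ((Category.assoc _ _ _).symm.trans hr)⟩

end Homotopy

end FakePullbacks

theorem mainTheorem1 {S : Type u} [Bicategory.{w, v} S]
    (F : FakePullbacks.FactorizationSystem S) (hF : FakePullbacks.FakePullbackReady F) :
    (∀ {O V W : S} (r : O ⟶ W) (s : V ⟶ W), Nonempty (FakePullbacks.FakePullback F r s)) ∧
    ∃ comp : ∀ X Y Z : S, FakePullbacks.SpanClass X Y → FakePullbacks.SpanClass Y Z →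
        FakePullbacks.SpanClass X Z,
      (∀ {X Y Z : S} (p : FakePullbacks.BiSpan X Y) (q : FakePullbacks.BiSpan Y Z)
        (D : FakePullbacks.FakePullback F p.right q.left),
        comp X Y Z (FakePullbacks.SpanClass.mk p) (FakePullbacks.SpanClass.mk q) =
          FakePullbacks.SpanClass.mk D.composite) ∧
      ∃ C : Category.{max u v} (FakePullbacks.Spn S),
        C.toCategoryStruct = FakePullbacks.Spn.categoryStruct comp := by
  have := hF.locally_preordered
  let fake {O V W : S} (r : O ⟶ W) (s : V ⟶ W) := (hF.nonempty_fakePullback r s).some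
  let comp : ∀ X Y Z : S, FakePullbacks.SpanClass X Y → FakePullbacks.SpanClass Y Z →
      FakePullbacks.SpanClass X Z := fun X Y Z => Quotient.lift₂
    (fun p q => FakePullbacks.SpanClass.mk (fake p.right q.left).composite)
    fun _ _ _ _ hp hq => hF.mk_composite_eq (Quotient.sound hp) (Quotient.sound hq) _ _
  refine ⟨hF.nonempty_fakePullback, comp,
    -- With the spans fixed, only the chosen fake pullback is replaced by the arbitrary `D`.
    fun p q D => hF.mk_composite_eq rfl rfl _ D,
    { FakePullbacks.Spn.categoryStruct comp with
      id_comp := ?_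
      comp_id := ?_
      assoc := ?_ }, rfl⟩
  · rintro X Y ⟨p⟩
    exact hF.mk_composite_id_left p _
  · rintro X Y ⟨p⟩
    exact hF.mk_composite_id_right p _
  · rintro X Y Z W ⟨p⟩ ⟨q⟩ ⟨t⟩
    exact hF.mk_composite_assoc (fake p.right q.left) (fake q.right t.left) _ _
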